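/- Let $n\ge 1$ be a natural number, and let $E^1_n$ denote the lightface class $\Pi^1_n$ of the analytical hierarchy if $n$ is odd and $\Sigma^1_n$ if $n$ is even. A numbering of a family $\mathcal S\subseteq P(\omega)$ is a surjection $\nu:\omega\to\mathcal S$; it is $E^1_n$-computable if $\{\langle k,x\rangle : x\in\nu(k)\}$ is an $E^1_n$ set, and $\mathcal S$ is $E^1_n$-computable if it has an $E^1_n$-computable numbering. For numberings, $\nu\le\mu$ means that there is a total computable function $f$ with $\nu(k)=\mu(f(k))$ for all $k$, and $\nu\oplus\mu$ is given by $(\nu\oplus\mu)(2x)=\nu(x)$, $(\nu\oplus\mu)(2x+1)=\mu(x)$. The Rogers semilattice $\mathcal R^1_n(\mathcal S)$ is the upper semilattice of all $E^1_n$-computable numberings of $\mathcal S$ modulo the equivalence ($\nu\le\mu$ and $\mu\le\nu$), with the order induced by $\le$ and the join induced by $\oplus$. An upper semilattice $(A;\le,\vee)$ is distributive if for all $b,a_0,a_1\in A$ with $b\le a_0\vee a_1$ there are $b_0\le a_0$ and $b_1\le a_1$ in $A$ with $b=b_0\vee b_1$; it is weakly distributive if the upper semilattice obtained from it by adding an external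 least element $\bot$ is distributive. Theorem. For every $n\ge 1$ and every infinite $E^1_n$-computable family $\mathcal S$, the semilattice $\mathcal R^1_n(\mathcal S)$ is not weakly distributive, and hence not distributive. (No determinacy hypothesis is assumed.) -/

import Mathlib

/-! ### Relativized computability -/

/-- Programs with access to one oracle `ℕ → ℕ`: the indices `e` of the functionals `φ_e`. -/
inductive OracleCode : Type
  | zero : OracleCode
  | succ : OracleCode
  | left : OracleCode
  | right : OracleCode
  | oracle : OracleCode
  | pair : OracleCode → OracleCode → OracleCode
  | comp : OracleCode → OracleCode → OracleCode
  | prec : OracleCode → OracleCode → OracleCode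
  | rfind : OracleCode → OracleCode

/-- `c.eval g` is the partial function computed by the program `c` with the oracle `g`. -/
def OracleCode.eval (g : ℕ → ℕ) : OracleCode → ℕ → Part ℕ
  | .zero => fun _ => Part.some 0
  | .succ => fun k => Part.some (k + 1)
  | .left => fun k => Part.some k.unpair.1
  | .right => fun k => Part.some k.unpair.2
  | .oracle => fun k => Part.some (g k)
  | .pair c d => fun k => Nat.pair <$> c.eval g k <*> d.eval g k
  | .comp c d => fun k => (d.eval g k).bind (c.eval g)
  | .prec c d => fun p =>
      Nat.rec (c.eval g p.unpair.1)
        (fun y ih => ih.bind fun i => d.eval g (Nat.pair p.unpair.1 (Nat.pair y i))) p.unpair.2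
  | .rfind c => fun a => Nat.rfind fun k => (fun m => decide (m = 0)) <$> c.eval g (Nat.pair a k)

/-- The join `f₁ ⊕ ⋯ ⊕ fₙ`, given by `(f₁ ⊕ ⋯ ⊕ fₙ) (n * k + i) = fᵢ₊₁ k` for `i < n`
(and the zero function if `n = 0`). -/
def oracleJoin {n : ℕ} (F : Fin n → ℕ → ℕ) (k : ℕ) : ℕ :=
  if h : 0 < n then F ⟨k % n, Nat.mod_lt k h⟩ (k / n) else 0

/-- A predicate `R(x, y; f₁, …, fₙ)` of two numbers and `n` functions is recursive if a single
program, with oracle `f₁ ⊕ ⋯ ⊕ fₙ`, halts on all inputs `x, y` for all `f₁, …, fₙ`, and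
returns `1` exactly when the predicate is true. -/
def IsRecursivePredicate {n : ℕ} (R : ℕ → ℕ → (Fin n → ℕ → ℕ) → Prop) : Prop :=
  ∃ c : OracleCode, ∀ (x y : ℕ) (F : Fin n → ℕ → ℕ),
    (c.eval (oracleJoin F) (Nat.pair x y)).Dom ∧
      (R x y F ↔ 1 ∈ c.eval (oracleJoin F) (Nat.pair x y))

/-! ### The analytical hierarchy -/

/-- `altQuant b n P` is the alternating statement `(Q₁ f₁) (Q₂ f₂) ⋯ (Qₙ fₙ) (Qₙ₊₁ y) P(f; y)`
with `n` function quantifiers followed by one number quantifier, where consecutive quantifiers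
are different and the first one is `∀` if `b = true` and `∃` if `b = false`. -/
def altQuant : Bool → (n : ℕ) → ((Fin n → ℕ → ℕ) → ℕ → Prop) → Prop
  | true, 0, P => ∀ y : ℕ, P Fin.elim0 y
  | false, 0, P => ∃ y : ℕ, P Fin.elim0 y
  | true, n + 1, P => ∀ f : ℕ → ℕ, altQuant false n fun F y => P (Fin.cons f F) y
  | false, n + 1, P => ∃ f : ℕ → ℕ, altQuant true n fun F y => P (Fin.cons f F) y

/-- Sets of numbers with a normal form of `n` function quantifiers, starting with `∀` if
`b = true` and with `∃` if `b = false`. -/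
def HasAnalyticalForm (b : Bool) (n : ℕ) (X : Set ℕ) : Prop :=
  ∃ R : ℕ → ℕ → (Fin n → ℕ → ℕ) → Prop, IsRecursivePredicate R ∧
    ∀ a : ℕ, a ∈ X ↔ altQuant b n fun F y => R a y F

/-- The lightface class `Π¹ₙ` (for `n ≥ 1`). -/
def IsPiOne (n : ℕ) (X : Set ℕ) : Prop := HasAnalyticalForm true n X

/-- The lightface class `Σ¹ₙ` (for `n ≥ 1`). -/
def IsSigmaOne (n : ℕ) (X : Set ℕ) : Prop := HasAnalyticalForm false n X

/-- The class `E¹ₙ` (for `n ≥ 1`): it is `Π¹ₙ` for odd `n` and `Σ¹ₙ` for even `n`. -/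
def IsEpsilonOne (n : ℕ) (X : Set ℕ) : Prop :=
  if Odd n then IsPiOne n X else IsSigmaOne n X

/-! ### Numberings -/

/-- Reducibility `ν ≤ μ` of numberings. -/
def NumberingReducible (ν μ : ℕ → Set ℕ) : Prop :=
  ∃ f : ℕ → ℕ, Computable f ∧ ∀ k, ν k = μ (f k)

/-- The numbering `ν ⊕ μ`, with `(ν ⊕ μ) (2x) = ν x` and `(ν ⊕ μ) (2x + 1) = μ x`. -/
def numberingJoin (ν μ : ℕ → Set ℕ) (k : ℕ) : Set ℕ :=
  if k % 2 = 0 then ν (k / 2) else μ (k / 2)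

/-- The set `G_ν = {⟨k, x⟩ : x ∈ ν k}`. -/
def numberingGraph (ν : ℕ → Set ℕ) : Set ℕ :=
  {z | z.unpair.2 ∈ ν z.unpair.1}

/-- `ν` is an `E¹ₙ`-computable numbering of the family `S`. -/
def IsEpsilonNumbering (n : ℕ) (S : Set (Set ℕ)) (ν : ℕ → Set ℕ) : Prop :=
  Set.range ν = S ∧ IsEpsilonOne n (numberingGraph ν)

/-- The family `S` is `E¹ₙ`-computable. -/
def IsEpsilonComputableFamily (n : ℕ) (S : Set (Set ℕ)) : Prop :=
  ∃ ν : ℕ → Set ℕ, IsEpsilonNumbering n S ν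

/-! ### Closure of `E¹ₙ`-computable numberings under joins -/

theorem OracleCode.exists_eval_eq_of_partrec {f : ℕ →. ℕ} (hf : Nat.Partrec f) :
    ∃ c : OracleCode, ∀ g, c.eval g = f := by
  induction hf with
  | zero => exact ⟨.zero, fun _ => rfl⟩
  | succ => exact ⟨.succ, fun _ => rfl⟩
  | left => exact ⟨.left, fun _ => rfl⟩
  | right => exact ⟨.right, fun _ => rfl⟩
  | pair _ _ ihf ihg =>
    obtain ⟨c, hc⟩ := ihf
    obtain ⟨d, hd⟩ := ihg
    exact ⟨.pair c d, fun g => by simp only [OracleCode.eval, hc, hd]⟩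
  | comp _ _ ihf ihg =>
    obtain ⟨c, hc⟩ := ihf
    obtain ⟨d, hd⟩ := ihg
    exact ⟨.comp c d, fun g => by simp only [OracleCode.eval, hc, hd]; rfl⟩
  | prec _ _ ihf ihg =>
    obtain ⟨c, hc⟩ := ihf
    obtain ⟨d, hd⟩ := ihg
    exact ⟨.prec c d, fun g => by simp only [OracleCode.eval, hc, hd]; rfl⟩
  | rfind _ ihf =>
    obtain ⟨c, hc⟩ := ihf
    exact ⟨.rfind c, fun g => by simp only [OracleCode.eval, hc]⟩

theorem OracleCode.exists_eval_eq_of_computable {f : ℕ → ℕ} (hf : Computable f) :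
    ∃ c : OracleCode, ∀ g k, c.eval g k = Part.some (f k) := by
  obtain ⟨c, hc⟩ := OracleCode.exists_eval_eq_of_partrec (Partrec.nat_iff.1 hf.partrec)
  exact ⟨c, fun g k => by rw [hc]; rfl⟩

theorem HasAnalyticalForm.numberingJoin {b : Bool} {n : ℕ} {ν μ : ℕ → Set ℕ}
    (hν : HasAnalyticalForm b n (numberingGraph ν))
    (hμ : HasAnalyticalForm b n (numberingGraph μ)) :
    HasAnalyticalForm b n (numberingGraph (numberingJoin ν μ)) := by
  obtain ⟨R, ⟨c, hc⟩, hR⟩ := hν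
  obtain ⟨T, ⟨d, hd⟩, hT⟩ := hμ
  let t : ℕ → ℕ := fun z => Nat.pair (z.unpair.1 / 2) z.unpair.2
  refine ⟨fun z y F => if z.unpair.1 % 2 = 0 then R (t z) y F else T (t z) y F, ?_, ?_⟩
  · have ht : Primrec t :=
      Primrec₂.natPair.comp
        (Primrec.nat_div.comp (Primrec.fst.comp Primrec.unpair) (Primrec.const 2))
        (Primrec.snd.comp Primrec.unpair)
    have h1 : Primrec fun p : ℕ => Nat.pair (t p.unpair.1) p.unpair.2 :=
      Primrec₂.natPair.comp (ht.comp (Primrec.fst.comp Primrec.unpair))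
        (Primrec.snd.comp Primrec.unpair)
    have h2 : Primrec fun p : ℕ => p.unpair.1.unpair.1 % 2 :=
      Primrec.nat_mod.comp (Primrec.fst.comp (Primrec.unpair.comp
        (Primrec.fst.comp Primrec.unpair))) (Primrec.const 2)
    have h3 : Primrec fun p : ℕ =>
        if p.unpair.1 = 0 then p.unpair.2.unpair.1 else p.unpair.2.unpair.2 :=
      Primrec.ite (Primrec.eq.comp (Primrec.fst.comp Primrec.unpair) (Primrec.const 0))
        (Primrec.fst.comp (Primrec.unpair.comp (Primrec.snd.comp Primrec.unpair)))
        (Primrec.snd.comp (Primrec.unpair.comp (Primrec.snd.comp Primrec.unpair)))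
    obtain ⟨e1, he1⟩ := OracleCode.exists_eval_eq_of_computable h1.to_comp
    obtain ⟨e2, he2⟩ := OracleCode.exists_eval_eq_of_computable h2.to_comp
    obtain ⟨e3, he3⟩ := OracleCode.exists_eval_eq_of_computable h3.to_comp
    refine ⟨.comp e3 (.pair e2 (.pair (.comp c e1) (.comp d e1))), fun z y F => ?_⟩
    obtain ⟨hc1, hc2⟩ := hc (t z) y F
    obtain ⟨hd1, hd2⟩ := hd (t z) y F
    obtain ⟨u, hu⟩ := Part.dom_iff_mem.1 hc1
    obtain ⟨v, hv⟩ := Part.dom_iff_mem.1 hd1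
    rw [← Part.eq_some_iff] at hu hv
    rw [hu] at hc2
    rw [hv] at hd2
    have key : (OracleCode.comp e3 (.pair e2 (.pair (.comp c e1) (.comp d e1)))).eval
        (oracleJoin F) (Nat.pair z y) = Part.some (if z.unpair.1 % 2 = 0 then u else v) := by
      simp [OracleCode.eval, he1, he2, he3, hu, hv, Seq.seq]
    rw [key]
    refine ⟨trivial, ?_⟩
    by_cases h : z.unpair.1 % 2 = 0
    · simpa [h] using hc2
    · simpa [h] using hd2
  · intro z
    have h0 : z ∈ numberingGraph (_root_.numberingJoin ν μ) ↔
        if z.unpair.1 % 2 = 0 then t z ∈ numberingGraph ν else t z ∈ numberingGraph μ := by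
      by_cases h : z.unpair.1 % 2 = 0 <;> simp [numberingGraph, _root_.numberingJoin, t, h]
    rw [h0]
    by_cases h : z.unpair.1 % 2 = 0
    · simpa [h] using hR (t z)
    · simpa [h] using hT (t z)

theorem IsEpsilonNumbering.numberingJoin {n : ℕ} {S : Set (Set ℕ)} {ν μ : ℕ → Set ℕ}
    (hν : IsEpsilonNumbering n S ν) (hμ : IsEpsilonNumbering n S μ) :
    IsEpsilonNumbering n S (numberingJoin ν μ) := by
  obtain ⟨hν, hν'⟩ := hν
  obtain ⟨hμ, hμ'⟩ := hμ
  refine ⟨Set.Subset.antisymm ?_ ?_, ?_⟩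
  · rintro _ ⟨k, rfl⟩
    unfold _root_.numberingJoin
    split_ifs
    · rw [← hν]; exact ⟨_, rfl⟩
    · rw [← hμ]; exact ⟨_, rfl⟩
  · rw [← hν]
    rintro _ ⟨k, rfl⟩
    exact ⟨2 * k, by simp [_root_.numberingJoin]⟩
  · unfold IsEpsilonOne at hν' hμ' ⊢
    split_ifs at hν' hμ' ⊢
    · exact HasAnalyticalForm.numberingJoin hν' hμ'
    · exact HasAnalyticalForm.numberingJoin hν' hμ'

/-! ### Rogers semilattices -/

/-- The set `Com(S)` of all `E¹ₙ`-computable numberings of `S`. -/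
def EpsilonNumbering (n : ℕ) (S : Set (Set ℕ)) : Type :=
  {ν : ℕ → Set ℕ // IsEpsilonNumbering n S ν}

instance EpsilonNumbering.instPreorder (n : ℕ) (S : Set (Set ℕ)) :
    Preorder (EpsilonNumbering n S) where
  le ν μ := NumberingReducible ν.1 μ.1
  le_refl _ := ⟨id, Computable.id, fun _ => rfl⟩
  le_trans := by
    rintro ν μ ξ ⟨f, hf, hf'⟩ ⟨g, hg, hg'⟩
    exact ⟨g ∘ f, hg.comp hf, fun k => (hf' k).trans (hg' _)⟩

/-- The join of two `E¹ₙ`-computable numberings of `S`. -/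
def EpsilonNumbering.join {n : ℕ} {S : Set (Set ℕ)} (ν μ : EpsilonNumbering n S) :
    EpsilonNumbering n S :=
  ⟨numberingJoin ν.1 μ.1, ν.2.numberingJoin μ.2⟩

theorem EpsilonNumbering.le_join_left {n : ℕ} {S : Set (Set ℕ)} (ν μ : EpsilonNumbering n S) :
    ν ≤ ν.join μ :=
  ⟨fun k => 2 * k, (Primrec.nat_mul.comp (Primrec.const 2) Primrec.id).to_comp,
    fun k => by simp [EpsilonNumbering.join, numberingJoin]⟩

theorem EpsilonNumbering.le_join_right {n : ℕ} {S : Set (Set ℕ)} (ν μ : EpsilonNumbering n S) :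
    μ ≤ ν.join μ :=
  ⟨fun k => 2 * k + 1,
    (Primrec.succ.comp (Primrec.nat_mul.comp (Primrec.const 2) Primrec.id)).to_comp,
    fun k => by
      have h : (2 * k + 1) / 2 = k := by omega
      simp [EpsilonNumbering.join, numberingJoin, h]⟩

theorem EpsilonNumbering.join_le {n : ℕ} {S : Set (Set ℕ)} {ν μ ξ : EpsilonNumbering n S}
    (h₁ : ν ≤ ξ) (h₂ : μ ≤ ξ) : ν.join μ ≤ ξ := by
  obtain ⟨f, hf, hf'⟩ := h₁
  obtain ⟨g, hg, hg'⟩ := h₂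
  have hdiv : Computable fun k : ℕ => k / 2 :=
    (Primrec.nat_div.comp Primrec.id (Primrec.const 2)).to_comp
  have hmod : Computable fun k : ℕ => decide (k % 2 = 0) :=
    (Primrec.eq.comp (Primrec.nat_mod.comp Primrec.id (Primrec.const 2))
      (Primrec.const 0)).decide.to_comp
  refine ⟨fun k => bif decide (k % 2 = 0) then f (k / 2) else g (k / 2),
    Computable.cond hmod (hf.comp hdiv) (hg.comp hdiv), fun k => ?_⟩
  by_cases h : k % 2 = 0
  · simpa [EpsilonNumbering.join, numberingJoin, h] using hf' (k / 2)
  · simpa [EpsilonNumbering.join, numberingJoin, h] using hg' (k / 2)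

/-- The Rogers semilattice `R¹ₙ(S)`: the `E¹ₙ`-computable numberings of `S` up to equivalence
(`ν ≤ μ` and `μ ≤ ν`), ordered by reducibility. -/
abbrev RogersSemilattice (n : ℕ) (S : Set (Set ℕ)) : Type :=
  Antisymmetrization (EpsilonNumbering n S) (· ≤ ·)

/-- The supremum of the degrees of `ν` and `μ` is the degree of `ν ⊕ μ`. -/
instance RogersSemilattice.instSemilatticeSup (n : ℕ) (S : Set (Set ℕ)) :
    SemilatticeSup (RogersSemilattice n S) where
  __ := instPartialOrderAntisymmetrization
  sup := Quotient.map₂ EpsilonNumbering.join fun _ _ h₁ _ _ h₂ =>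
    ⟨EpsilonNumbering.join_le (le_trans h₁.1 (EpsilonNumbering.le_join_left _ _))
        (le_trans h₂.1 (EpsilonNumbering.le_join_right _ _)),
      EpsilonNumbering.join_le (le_trans h₁.2 (EpsilonNumbering.le_join_left _ _))
        (le_trans h₂.2 (EpsilonNumbering.le_join_right _ _))⟩
  le_sup_left := by
    rintro ⟨ν⟩ ⟨μ⟩
    exact EpsilonNumbering.le_join_left ν μ
  le_sup_right := by
    rintro ⟨ν⟩ ⟨μ⟩
    exact EpsilonNumbering.le_join_right ν μ
  sup_le := by
    rintro ⟨ν⟩ ⟨μ⟩ ⟨ξ⟩ h₁ h₂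
    exact EpsilonNumbering.join_le (ν := ν) (μ := μ) (ξ := ξ) h₁ h₂

/-! ### Distributivity of upper semilattices -/

/-- An upper semilattice is distributive if `b ≤ a₀ ⊔ a₁` always implies `b = b₀ ⊔ b₁` for
some `b₀ ≤ a₀` and `b₁ ≤ a₁`. -/
def IsDistributiveSup (A : Type*) [SemilatticeSup A] : Prop :=
  ∀ b a₀ a₁ : A, b ≤ a₀ ⊔ a₁ → ∃ b₀ b₁ : A, b = b₀ ⊔ b₁ ∧ b₀ ≤ a₀ ∧ b₁ ≤ a₁

/-- An upper semilattice is weakly distributive if it becomes distributive after an external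
least element has been added to it. -/
def IsWeaklyDistributiveSup (A : Type*) [SemilatticeSup A] : Prop :=
  IsDistributiveSup (WithBot A)

/-! Everything comes from one 1-generic function h. Fix an E¹ₙ-computable numbering ν of S with ν u
≠ ν v and read each value of h as a triple. Let ε and δ be ν applied to the first and second
component of h, and let σ be ν u or ν v according to the third. Put β = σ ⊕ ε, α₀ = σ ⊕ δ and α₁ =
ε, so that β ≤ α₀ ⊕ α₁.

Genericity makes the components independent, so a numbering below both β and α₀ has finite range
(`finite_range_of_reducible`) and cannot number S. In a splitting of β, the part below α₀ is also
below β, so it can only be the external ⊥. Then β ≤ α₁, hence σ ≤ ε, which genericity also refutes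
(`not_reducible_tripleFst`).

For σ, ε, δ to stay E¹ₙ-computable, h must be simple. It is read off a function G, the stages of a
finite extension construction, which is the only solution of a Π⁰₁ condition
(`isLocallyCheckable_stage`). For every n ≥ 1 the normal form of E¹ₙ ends in ∀f ∃y, and this ∀f can
absorb a guess for G: a wrong guess is refuted by some y (`HasAnalyticalForm.preimage`). -/

/-! ### Functionals computed by total oracle programs -/

/-- The functional `Φ` is computed by one program that halts for all oracles and inputs. -/
def IsOracleComputable (Φ : (ℕ → ℕ) → ℕ → ℕ) : Prop :=
  ∃ c : OracleCode, ∀ g k, c.eval g k = Part.some (Φ g k)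

/-- Replace the oracle queries of a program by calls of the program `d`. -/
def OracleCode.subst : OracleCode → OracleCode → OracleCode
  | .zero, _ => .zero
  | .succ, _ => .succ
  | .left, _ => .left
  | .right, _ => .right
  | .oracle, d => d
  | .pair a b, d => .pair (a.subst d) (b.subst d)
  | .comp a b, d => .comp (a.subst d) (b.subst d)
  | .prec a b, d => .prec (a.subst d) (b.subst d)
  | .rfind a, d => .rfind (a.subst d)

theorem OracleCode.eval_subst {d : OracleCode} {g g' : ℕ → ℕ}
    (hd : ∀ k, d.eval g k = Part.some (g' k)) (c : OracleCode) :
    (c.subst d).eval g = c.eval g' := by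
  induction c with
  | zero | succ | left | right => rfl
  | oracle => funext k; simp [OracleCode.subst, OracleCode.eval, hd]
  | pair a b iha ihb | comp a b iha ihb | prec a b iha ihb =>
    simp only [OracleCode.subst, OracleCode.eval, iha, ihb]
  | rfind a iha => simp only [OracleCode.subst, OracleCode.eval, iha]

namespace IsOracleComputable

variable {Φ Ψ : (ℕ → ℕ) → ℕ → ℕ}

theorem of_computable {f : ℕ → ℕ} (hf : Computable f) : IsOracleComputable fun _ => f :=
  OracleCode.exists_eval_eq_of_computable hf

theorem oracle : IsOracleComputable fun g k => g k :=
  ⟨.oracle, fun _ _ => rfl⟩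

theorem comp (hΦ : IsOracleComputable Φ) (hΨ : IsOracleComputable Ψ) :
    IsOracleComputable fun g k => Φ g (Ψ g k) := by
  obtain ⟨c, hc⟩ := hΦ
  obtain ⟨d, hd⟩ := hΨ
  exact ⟨.comp c d, fun g k => by simp [OracleCode.eval, hc, hd]⟩

theorem query (hΦ : IsOracleComputable Φ) : IsOracleComputable fun g k => g (Φ g k) :=
  oracle.comp hΦ

theorem pair (hΦ : IsOracleComputable Φ) (hΨ : IsOracleComputable Ψ) :
    IsOracleComputable fun g k => Nat.pair (Φ g k) (Ψ g k) := by
  obtain ⟨c, hc⟩ := hΦ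
  obtain ⟨d, hd⟩ := hΨ
  exact ⟨.pair c d, fun g k => by simp [OracleCode.eval, hc, hd, Seq.seq]⟩

theorem subst (hΦ : IsOracleComputable Φ) (hΨ : IsOracleComputable Ψ) :
    IsOracleComputable fun g => Φ (Ψ g) := by
  obtain ⟨c, hc⟩ := hΦ
  obtain ⟨d, hd⟩ := hΨ
  exact ⟨c.subst d, fun g k => by rw [OracleCode.eval_subst (hd g), hc]⟩

end IsOracleComputable

/-- With at least one function every oracle is a join, so a program that halts for all joins halts
for all oracles and computes a total functional. -/
theorem oracleJoin_surjective (m : ℕ) :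
    Function.Surjective (oracleJoin : (Fin (m + 1) → ℕ → ℕ) → ℕ → ℕ) := fun g =>
  ⟨fun i k => g ((m + 1) * k + i), by
    funext k
    simp [oracleJoin, Nat.div_add_mod]⟩

theorem isRecursivePredicate_iff {m : ℕ} {R : ℕ → ℕ → (Fin (m + 1) → ℕ → ℕ) → Prop} :
    IsRecursivePredicate R ↔ ∃ Φ, IsOracleComputable Φ ∧
      ∀ x y F, R x y F ↔ Φ (oracleJoin F) (Nat.pair x y) = 1 := by
  constructor
  · rintro ⟨c, hc⟩
    have hdom : ∀ g k, (c.eval g k).Dom := fun g k => by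
      obtain ⟨F, rfl⟩ := oracleJoin_surjective m g
      simpa using (hc k.unpair.1 k.unpair.2 F).1
    refine ⟨fun g k => (c.eval g k).get (hdom g k), ⟨c, fun g k => (Part.some_get _).symm⟩, ?_⟩
    intro x y F
    rw [(hc x y F).2, Part.get_eq_iff_mem]
  · rintro ⟨Φ, ⟨c, hc⟩, hR⟩
    refine ⟨c, fun x y F => ?_⟩
    rw [hc, hR]
    exact ⟨trivial, by simp [eq_comm]⟩

/-! ### Operations on the last function quantifier -/

theorem oracleJoin_snoc_last {m : ℕ} (F : Fin m → ℕ → ℕ) (f : ℕ → ℕ) (k : ℕ) :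
    oracleJoin (Fin.snoc F f : Fin (m + 1) → ℕ → ℕ) ((m + 1) * k + m) = f k := by
  have h1 : ((m + 1) * k + m) % (m + 1) = m := by
    rw [Nat.mul_add_mod, Nat.mod_eq_of_lt (Nat.lt_succ_self m)]
  have h2 : ((m + 1) * k + m) / (m + 1) = k := by
    rw [Nat.mul_add_div (Nat.succ_pos m), Nat.div_eq_of_lt (Nat.lt_succ_self m), add_zero]
  have h3 : (⟨((m + 1) * k + m) % (m + 1), Nat.mod_lt _ (Nat.succ_pos m)⟩ : Fin (m + 1)) =
      Fin.last m := Fin.ext h1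
  simp only [oracleJoin, Nat.succ_pos, dif_pos, h2, h3, Fin.snoc_last]

theorem oracleJoin_snoc_of_ne {m : ℕ} (F : Fin m → ℕ → ℕ) (f f' : ℕ → ℕ) {k : ℕ}
    (hk : k % (m + 1) ≠ m) :
    oracleJoin (Fin.snoc F f : Fin (m + 1) → ℕ → ℕ) k =
      oracleJoin (Fin.snoc F f' : Fin (m + 1) → ℕ → ℕ) k := by
  have hlt : k % (m + 1) < m := by
    have := Nat.mod_lt k (Nat.add_one_pos m)
    omega
  have h3 : (⟨k % (m + 1), Nat.mod_lt _ (Nat.succ_pos m)⟩ : Fin (m + 1)) =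
      Fin.castSucc ⟨k % (m + 1), hlt⟩ := rfl
  simp only [oracleJoin, Nat.succ_pos, dif_pos, h3, Fin.snoc_castSucc]

/-- Passing to the odd half of the last function is a computable change of queries, so the last
function can carry two. -/
theorem oracleJoin_snoc_odd {m : ℕ} (F : Fin m → ℕ → ℕ) (f : ℕ → ℕ) :
    (fun k => oracleJoin (Fin.snoc F f : Fin (m + 1) → ℕ → ℕ)
      (if k % (m + 1) = m then (m + 1) * (2 * (k / (m + 1)) + 1) + m else k)) =
      oracleJoin (Fin.snoc F fun j => f (2 * j + 1) : Fin (m + 1) → ℕ → ℕ) := by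
  funext k
  split_ifs with hk
  · rw [oracleJoin_snoc_last]
    conv_rhs => rw [← Nat.div_add_mod k (m + 1), hk, oracleJoin_snoc_last]
  · exact oracleJoin_snoc_of_ne F _ _ hk

/-- The parity condition on `b` says that the prefix ends in ∀f ∃y. Peeling off the outermost
quantifier flips `b` and the parity together. -/
theorem altQuant_congr_last (m : ℕ) {b : Bool} (hb : b = decide (Odd (m + 1)))
    {P P' : (Fin (m + 1) → ℕ → ℕ) → ℕ → Prop}
    (h : ∀ F : Fin m → ℕ → ℕ,
      (∀ f, ∃ y, P (Fin.snoc F f) y) ↔ ∀ f, ∃ y, P' (Fin.snoc F f) y) :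
    altQuant b (m + 1) P ↔ altQuant b (m + 1) P' := by
  induction m generalizing b with
  | zero =>
    subst hb
    have key : ∀ f : ℕ → ℕ, (Fin.cons f Fin.elim0 : Fin 1 → ℕ → ℕ) = Fin.snoc Fin.elim0 f :=
      fun f => by funext i; fin_cases i; rfl
    simp only [zero_add, odd_one, decide_true, altQuant, key]
    exact h Fin.elim0
  | succ m ih =>
    have step : ∀ f : ℕ → ℕ, altQuant (!b) (m + 1) (fun F y => P (Fin.cons f F) y) ↔
        altQuant (!b) (m + 1) (fun F y => P' (Fin.cons f F) y) := fun f => by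
      refine ih (by
        rw [hb, Bool.eq_iff_iff]
        simp only [Bool.not_eq_true', decide_eq_false_iff_not, decide_eq_true_iff,
          Nat.odd_add_one (n := m + 1), not_not]) fun F => ?_
      have := h (Fin.cons f F)
      simpa only [Fin.cons_snoc_eq_snoc_cons] using this
    cases b
    · exact exists_congr step
    · exact forall_congr' step

/-! ### Closure of the analytical classes under substitution of definable functions -/

/-- `G` is the only function that passes a computable test, each instance of which looks at two
values of the function. -/
def IsLocallyCheckable (G : ℕ → ℕ) : Prop :=
  ∃ (t : ℕ × ℕ × ℕ → Bool) (p q : ℕ → ℕ), Computable t ∧ Computable p ∧ Computable q ∧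
    ∀ f : ℕ → ℕ, (∀ y, t (y, f (p y), f (q y)) = true) ↔ f = G

theorem HasAnalyticalForm.preimage {m : ℕ} {b : Bool} (hb : b = decide (Odd (m + 1)))
    {X : Set ℕ} (hX : HasAnalyticalForm b (m + 1) X) {G : ℕ → ℕ} (hG : IsLocallyCheckable G)
    {D p : ℕ → ℕ} (hD : Computable D) (hp : Computable p) :
    HasAnalyticalForm b (m + 1) {z | D (Nat.pair z (G (p z))) ∈ X} := by
  obtain ⟨R, hR, hRX⟩ := hX
  obtain ⟨Φ, hΦ, hΦR⟩ := isRecursivePredicate_iff.1 hR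
  obtain ⟨t, q₁, q₂, ht, hq₁, hq₂, htG⟩ := hG
  -- Even entries of the last function are the guess for `G`; odd entries are the function that was
  -- quantified originally.
  let ev : ℕ → ℕ := fun i => (m + 1) * (2 * i) + m
  let od : ℕ → ℕ := fun k =>
    if k % (m + 1) = m then (m + 1) * (2 * (k / (m + 1)) + 1) + m else k
  have hev : Computable ev := by
    have : Primrec ev := Primrec.nat_add.comp (Primrec.nat_mul.comp (Primrec.const _)
      (Primrec.nat_mul.comp (Primrec.const 2) Primrec.id)) (Primrec.const _)
    exact this.to_comp
  have hod : Computable od := by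
    have : Primrec od := Primrec.ite
      (Primrec.eq.comp (Primrec.nat_mod.comp Primrec.id (Primrec.const _)) (Primrec.const _))
      (Primrec.nat_add.comp (Primrec.nat_mul.comp (Primrec.const _)
        (Primrec.succ.comp (Primrec.nat_mul.comp (Primrec.const 2)
          (Primrec.nat_div.comp Primrec.id (Primrec.const _))))) (Primrec.const _)) Primrec.id
    exact this.to_comp
  have hl : Computable fun k : ℕ => k.unpair.1 := Computable.fst.comp Computable.unpair
  have hr : Computable fun k : ℕ => k.unpair.2 := Computable.snd.comp Computable.unpair
  -- If the guess fails the test at `y`, the default `1` makes the new predicate true there.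
  let H : ℕ → ℕ := fun w =>
    bif t (w.unpair.1.unpair.1, w.unpair.1.unpair.2.unpair.1, w.unpair.1.unpair.2.unpair.2)
    then w.unpair.2 else 1
  have hH : Computable H := Computable.cond
    (ht.comp ((hl.comp hl).pair ((hl.comp (hr.comp hl)).pair (hr.comp (hr.comp hl)))))
    hr (Computable.const 1)
  let Ψ : (ℕ → ℕ) → ℕ → ℕ := fun g w => H (Nat.pair
    (Nat.pair w.unpair.2 (Nat.pair (g (ev (q₁ w.unpair.2))) (g (ev (q₂ w.unpair.2)))))
    (Φ (fun k => g (od k))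
      (Nat.pair (D (Nat.pair w.unpair.1 (g (ev (p w.unpair.1))))) w.unpair.2)))
  have hΨ : IsOracleComputable Ψ := by
    have e : ∀ {f : ℕ → ℕ}, Computable f → IsOracleComputable fun _ => f :=
      fun hf => IsOracleComputable.of_computable hf
    exact (e hH).comp (((e hr).pair ((e (hev.comp (hq₁.comp hr))).query.pair
      (e (hev.comp (hq₂.comp hr))).query)).pair ((hΦ.subst (e hod).query).comp
        (((e hD).comp ((e hl).pair (e (hev.comp (hp.comp hl))).query)).pair (e hr))))
  refine ⟨fun x y F => Ψ (oracleJoin F) (Nat.pair x y) = 1,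
    isRecursivePredicate_iff.2 ⟨Ψ, hΨ, fun _ _ _ => Iff.rfl⟩, fun z => ?_⟩
  rw [Set.mem_ofPred_eq, hRX]
  refine altQuant_congr_last m hb fun F => ?_
  have key : ∀ f y, Ψ (oracleJoin (Fin.snoc F f : Fin (m + 1) → ℕ → ℕ)) (Nat.pair z y) = 1 ↔
      (t (y, f (2 * q₁ y), f (2 * q₂ y)) = true →
        R (D (Nat.pair z (f (2 * p z)))) y (Fin.snoc F fun j => f (2 * j + 1))) := by
    intro f y
    rw [hΦR, ← oracleJoin_snoc_odd]
    simp only [Ψ, H, ev, od, Nat.unpair_pair, oracleJoin_snoc_last]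
    cases t (y, f (2 * q₁ y), f (2 * q₂ y)) <;> simp
  simp only [key]
  constructor
  · intro h f
    by_cases hf : (fun i => f (2 * i)) = G
    · obtain ⟨y, hy⟩ := h fun j => f (2 * j + 1)
      refine ⟨y, fun _ => ?_⟩
      rw [← hf] at hy
      exact hy
    · rw [← htG] at hf
      push Not at hf
      obtain ⟨y, hy⟩ := hf
      exact ⟨y, fun h => absurd h hy⟩
  · intro h f
    obtain ⟨y, hy⟩ := h fun k => if k % 2 = 0 then G (k / 2) else f (k / 2)
    have h2 : ∀ j, (2 * j + 1) / 2 = j := fun j => by omega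
    refine ⟨y, ?_⟩
    have := hy (by simpa using (htG G).2 rfl y)
    simpa [Nat.add_mod, h2] using this

/-! ### A locally checkable generic function -/

/-- `h` is 1-generic: every r.e. set of strings contains an initial segment of `h` or no extension
of some initial segment of `h`. -/
def IsOneGeneric (h : ℕ → ℕ) : Prop :=
  ∀ W : List ℕ → Prop, REPred W → ∃ τ : List ℕ, (∀ k a, τ[k]? = some a → h k = a) ∧
    (W τ ∨ ∀ ρ, ¬ W (τ ++ ρ))

namespace GenericConstruction

open Encodable Denumerable

open Nat.Partrec (Code)

/-- The string proposed as an extension by the candidate `c`. -/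
def extension (c : ℕ) : List ℕ := (decode c.unpair.1 : Option (List ℕ)).getD []

/-- The candidate `c` shows that the `i`-th r.e. set contains an extension of `σ`. -/
def IsWitness (i : ℕ) (σ : List ℕ) (c : ℕ) : Prop :=
  (Code.evaln c.unpair.2 (ofNat Code i) (encode (σ ++ extension c))).isSome = true

/-- The string that follows `σ` if the least witness is `w - 1` (no witness if `w = 0`). -/
def nextString (σ : List ℕ) (w : ℕ) : List ℕ :=
  σ ++ ((if w = 0 then [] else extension (w - 1)) ++ [0])

open Classical in
/-- The successor of the least witness, and `0` if there is no witness. -/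
noncomputable def leastWitness (i : ℕ) (σ : List ℕ) : ℕ :=
  if h : ∃ c, IsWitness i σ c then Nat.find h + 1 else 0

/-- The instance `y` of the statement that `w` is the least witness. -/
def LeastWitnessTest (i : ℕ) (σ : List ℕ) (w y : ℕ) : Prop :=
  (w = 0 ∧ ¬ IsWitness i σ y) ∨
    (w ≠ 0 ∧ IsWitness i σ (w - 1) ∧ ¬ (y < w - 1 ∧ IsWitness i σ y))

/-- A candidate carries its own step bound, so being a witness is decidable; only minimality, or
absence of witnesses, needs the quantifier over `y`. -/
theorem forall_leastWitnessTest {i : ℕ} {σ : List ℕ} {w : ℕ} :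
    (∀ y, LeastWitnessTest i σ w y) ↔ w = leastWitness i σ := by
  classical
  unfold LeastWitnessTest leastWitness
  rcases w with _ | c
  · split_ifs with h
    · obtain ⟨c, hc⟩ := h
      simpa using ⟨c, hc⟩
    · push Not at h
      simpa using h
  · split_ifs with h
    · simp only [Nat.add_sub_cancel, Nat.add_right_cancel_iff, eq_comm (a := c),
        Nat.find_eq_iff]
      simp [forall_and]
    · push Not at h
      simp [h]

/-- The stages of the construction: the last witness and the current string. -/
noncomputable def stage : ℕ → ℕ × List ℕ
  | 0 => (0, [])
  | i + 1 => (leastWitness i (stage i).2, nextString (stage i).2 (leastWitness i (stage i).2))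

/-- Decoding of stages. -/
def decodeStage (a : ℕ) : ℕ × List ℕ := (decode a).getD (0, [])

@[simp]
theorem decodeStage_encode (s : ℕ × List ℕ) : decodeStage (encode s) = s := by
  rw [decodeStage, encodek, Option.getD_some]

/-- The local test for the sequence of stages. -/
def StageTest (w : ℕ × ℕ × ℕ) : Prop :=
  w.2.2 = encode ((decodeStage w.2.2).1,
    nextString (decodeStage w.2.1).2 (decodeStage w.2.2).1) ∧
  LeastWitnessTest w.1.unpair.1 (decodeStage w.2.1).2 (decodeStage w.2.2).1 w.1.unpair.2 ∧
  (w.1.unpair.1 ≠ 0 ∨ w.2.1 = encode ((0, []) : ℕ × List ℕ))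

/-- By induction: the clause for index 0 fixes the start, and the tests for all `y` coding index i
determine f (i + 1) from f i. -/
theorem forall_stageTest {f : ℕ → ℕ} :
    (∀ y : ℕ, StageTest (y, f y.unpair.1, f (y.unpair.1 + 1))) ↔
      f = fun i => encode (stage i) := by
  constructor
  · intro h
    funext i
    induction i with
    | zero =>
      have := (h (Nat.pair 0 0)).2.2
      simpa [stage] using this
    | succ i ih =>
      have hw : (decodeStage (f (i + 1))).1 = leastWitness i (stage i).2 := by
        rw [← forall_leastWitnessTest]
        intro y
        have := (h (Nat.pair i y)).2.1
        simpa [ih] using this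
      have := (h (Nat.pair i 0)).1
      simp only [Nat.unpair_pair, hw, ih, decodeStage_encode] at this
      exact this
  · rintro rfl y
    refine ⟨?_, ?_, ?_⟩
    · simp only [decodeStage_encode, stage]
    · simp only [decodeStage_encode, stage]
      exact forall_leastWitnessTest.2 rfl _
    · by_cases h : y.unpair.1 = 0
      · right; simp [h, stage]
      · exact Or.inl h

/-! ### Primitive recursiveness of the local test. -/

theorem primrec_extension : Primrec extension :=
  Primrec.option_getD.comp (Primrec.decode.comp (Primrec.fst.comp Primrec.unpair))
    (Primrec.const [])

theorem primrec_decodeStage : Primrec decodeStage :=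
  Primrec.option_getD.comp Primrec.decode (Primrec.const (0, []))

theorem primrec_nextString : Primrec₂ nextString :=
  Primrec.list_append.comp Primrec.fst (Primrec.list_append.comp
    (Primrec.ite (Primrec.eq.comp Primrec.snd (Primrec.const 0)) (Primrec.const [])
      (primrec_extension.comp (Primrec.pred.comp Primrec.snd))) (Primrec.const [0]))

theorem primrecPred_isWitness {α : Type*} [Primcodable α] {i c : α → ℕ} {σ : α → List ℕ}
    (hi : Primrec i) (hσ : Primrec σ) (hc : Primrec c) :
    PrimrecPred fun x => IsWitness (i x) (σ x) (c x) :=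
  Primrec.eq.comp (Primrec.option_isSome.comp (Code.primrec_evaln.comp
    (((Primrec.snd.comp (Primrec.unpair.comp hc)).pair ((Primrec.ofNat Code).comp hi)).pair
      (Primrec.encode.comp (Primrec.list_append.comp hσ (primrec_extension.comp hc))))))
    (Primrec.const true)

theorem primrecPred_stageTest : PrimrecPred StageTest := by
  have hi : Primrec fun w : ℕ × ℕ × ℕ => w.1.unpair.1 :=
    Primrec.fst.comp (Primrec.unpair.comp Primrec.fst)
  have hy : Primrec fun w : ℕ × ℕ × ℕ => w.1.unpair.2 :=
    Primrec.snd.comp (Primrec.unpair.comp Primrec.fst)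
  have ha : Primrec fun w : ℕ × ℕ × ℕ => w.2.1 := Primrec.fst.comp Primrec.snd
  have hb : Primrec fun w : ℕ × ℕ × ℕ => w.2.2 := Primrec.snd.comp Primrec.snd
  have hσ : Primrec fun w : ℕ × ℕ × ℕ => (decodeStage w.2.1).2 :=
    Primrec.snd.comp (primrec_decodeStage.comp ha)
  have hw : Primrec fun w : ℕ × ℕ × ℕ => (decodeStage w.2.2).1 :=
    Primrec.fst.comp (primrec_decodeStage.comp hb)
  have hw' := Primrec.pred.comp hw
  have hw0 := Primrec.eq.comp hw (Primrec.const 0)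
  refine (Primrec.eq.comp hb (Primrec.encode.comp
    (hw.pair (primrec_nextString.comp hσ hw)))).and (PrimrecPred.and ?_
      ((Primrec.eq.comp hi (Primrec.const 0)).not.or (Primrec.eq.comp ha (Primrec.const _))))
  exact (hw0.and (primrecPred_isWitness hi hσ hy).not).or (hw0.not.and
    ((primrecPred_isWitness hi hσ hw').and
      ((Primrec.nat_lt.comp hy hw').and (primrecPred_isWitness hi hσ hy)).not))

theorem isLocallyCheckable_stage : IsLocallyCheckable fun i => encode (stage i) := by
  obtain ⟨hdec, ht⟩ := primrecPred_stageTest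
  refine ⟨fun w => decide (StageTest w), fun y => y.unpair.1, fun y => y.unpair.1 + 1,
    ht.to_comp, (Primrec.fst.comp Primrec.unpair).to_comp,
    (Primrec.succ.comp (Primrec.fst.comp Primrec.unpair)).to_comp, fun f => ?_⟩
  simpa using forall_stageTest (f := f)

/-! ### Genericity of the union of the stages. -/

theorem stage_prefix {i j : ℕ} (hij : i ≤ j) : (stage i).2 <+: (stage j).2 := by
  induction hij with
  | refl => exact List.prefix_rfl
  | step _ ih => exact ih.trans (List.prefix_append _ _)

/-- The `0` appended by `nextString` forces growth even without a witness, so the default value in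
`generic` is never used. -/
theorem le_length_stage (i : ℕ) : i ≤ (stage i).2.length := by
  induction i with
  | zero => exact Nat.zero_le _
  | succ i ih => simp only [stage, nextString, List.length_append, List.length_singleton]; omega

/-- The generic function, the union of the strings of all stages. -/
noncomputable def generic (k : ℕ) : ℕ := (stage (k + 1)).2.getD k 0

theorem generic_eq_of_stage {i k a : ℕ} (h : (stage i).2[k]? = some a) : generic k = a := by
  have h1 : ∀ {σ τ : List ℕ}, σ <+: τ → σ[k]? = some a → τ[k]? = some a := by
    rintro σ _ ⟨ρ, rfl⟩ h
    rw [List.getElem?_append_left (List.getElem?_eq_some_iff.1 h).1, h]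
  have hk : k < (stage (k + 1)).2.length := le_length_stage (k + 1)
  obtain ⟨b, hb⟩ : ∃ b, (stage (k + 1)).2[k]? = some b := ⟨_, List.getElem?_eq_getElem hk⟩
  have hab : b = a := by
    rcases le_total i (k + 1) with hik | hik
    · exact Option.some_inj.1 (hb.symm.trans (h1 (stage_prefix hik) h))
    · obtain ⟨ρ, hρ⟩ := stage_prefix hik
      rw [← hρ, List.getElem?_append_left hk, hb] at h
      exact Option.some_inj.1 h
  rw [generic, List.getD_eq_getElem?_getD, hb, hab, Option.getD_some]

theorem exists_index_of_rePred {W : List ℕ → Prop} (hW : REPred W) :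
    ∃ i, ∀ τ, W τ ↔ ∃ t, (Code.evaln t (ofNat Code i) (encode τ)).isSome = true := by
  obtain ⟨c, hc⟩ := Code.exists_code.1 hW
  refine ⟨encode c, fun τ => ?_⟩
  have h1 : (c.eval (encode τ)).Dom ↔ W τ := by
    rw [hc]
    simp [Part.assert]
  rw [← h1, ofNat_encode, Part.dom_iff_mem]
  simp only [Code.evaln_complete, Option.isSome_iff_exists, Option.mem_def]
  exact exists_comm

theorem isOneGeneric_generic : IsOneGeneric generic := by
  classical
  intro W hW
  obtain ⟨i, hi⟩ := exists_index_of_rePred hW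
  by_cases h : ∃ c, IsWitness i (stage i).2 c
  · have hw : IsWitness i (stage i).2 (Nat.find h) := Nat.find_spec h
    have hs : (stage (i + 1)).2 = (stage i).2 ++ (extension (Nat.find h) ++ [0]) := by
      simp [stage, nextString, leastWitness, h]
    refine ⟨(stage i).2 ++ extension (Nat.find h), fun k a hk => ?_,
      Or.inl ((hi _).2 ⟨_, hw⟩)⟩
    refine generic_eq_of_stage (i := i + 1) ?_
    rw [hs, ← List.append_assoc,
      List.getElem?_append_left (List.getElem?_eq_some_iff.1 hk).1, hk]
  · refine ⟨(stage i).2, fun k a hk => generic_eq_of_stage hk, Or.inr fun ρ hρ => h ?_⟩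
    obtain ⟨t, ht⟩ := (hi _).1 hρ
    exact ⟨Nat.pair (encode ρ) t, by simpa [IsWitness, extension] using ht⟩

end GenericConstruction

open GenericConstruction in
theorem exists_isOneGeneric : ∃ (h G D p : ℕ → ℕ), IsOneGeneric h ∧ IsLocallyCheckable G ∧
    Computable D ∧ Computable p ∧ ∀ k, h k = D (Nat.pair k (G (p k))) := by
  refine ⟨generic, fun i => Encodable.encode (stage i),
    fun w => (decodeStage w.unpair.2).2.getD w.unpair.1 0, fun k => k + 1,
    isOneGeneric_generic, isLocallyCheckable_stage, ?_, Computable.succ, fun k => ?_⟩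
  · exact ((Primrec.list_getD 0).comp
      (Primrec.snd.comp (primrec_decodeStage.comp (Primrec.snd.comp Primrec.unpair)))
      (Primrec.fst.comp Primrec.unpair)).to_comp
  · simp [generic]

/-- A 1-generic function takes given values at the points `f₀ x` and `f₁ x` for some `x` with
`c x`, unless there are no such points outside of a finite set. -/
theorem IsOneGeneric.exists_or_bounded {h : ℕ → ℕ} (hh : IsOneGeneric h) {f₀ f₁ : ℕ → ℕ}
    {c : ℕ → Bool} (hf₀ : Computable f₀) (hf₁ : Computable f₁) (hc : Computable c) (a b : ℕ) :
    (∃ x, c x = true ∧ h (f₀ x) = a ∧ h (f₁ x) = b) ∨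
      ∃ l, ∀ x, c x = true → f₀ x < l ∨ f₁ x < l ∨ (a ≠ b ∧ f₀ x = f₁ x) := by
  have hW : REPred fun τ : List ℕ =>
      ∃ x, c x = true ∧ τ[f₀ x]? = some a ∧ τ[f₁ x]? = some b := by
    have hdec : ∀ (v : ℕ) {f : ℕ → ℕ}, Computable f →
        Computable fun w : List ℕ × ℕ => decide (w.1[f w.2]? = some v) := fun v f hf =>
      Primrec.eq.decide.to_comp.comp
        (Primrec.list_getElem?.to_comp.comp Computable.fst (hf.comp Computable.snd))
        (Computable.const (some v))
    have hp : Computable₂ fun (τ : List ℕ) (x : ℕ) =>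
        c x && (decide (τ[f₀ x]? = some a) && decide (τ[f₁ x]? = some b)) :=
      Primrec.and.to_comp.comp (hc.comp Computable.snd)
        (Primrec.and.to_comp.comp (hdec a hf₀) (hdec b hf₁))
    refine (Partrec.dom_re (Partrec.rfind hp.partrec₂)).of_eq fun τ => ?_
    simp [Nat.rfind_dom]
  obtain ⟨τ, hτ, hW | hW⟩ := hh _ hW
  · obtain ⟨x, hx, h0, h1⟩ := hW
    exact Or.inl ⟨x, hx, hτ _ _ h0, hτ _ _ h1⟩
  · refine Or.inr ⟨τ.length, fun x hx => ?_⟩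
    by_contra! hcon
    obtain ⟨h0, h1, hne⟩ := hcon
    -- Fill all new positions by `g`. This is consistent: if the two points coincide, then `a = b`.
    let g : ℕ → ℕ := fun k => if k = f₀ x then a else b
    have hget : ∀ k, τ.length ≤ k → k ≤ f₀ x + f₁ x →
        (τ ++ (List.range (f₀ x + f₁ x + 1)).map fun j => g (τ.length + j))[k]? =
          some (g k) := by
      intro k hk hk'
      rw [List.getElem?_append_right hk, List.getElem?_map, List.getElem?_range (by omega)]
      simp [Nat.add_sub_cancel' hk]
    refine hW ((List.range (f₀ x + f₁ x + 1)).map fun j => g (τ.length + j))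
      ⟨x, hx, ?_, ?_⟩
    · rw [hget _ h0 (by omega)]; simp [g]
    · rw [hget _ h1 (by omega)]
      by_cases hab : a = b
      · simp [g, hab]
      · simp [g, Ne.symm (hne hab)]

/-! ### Numberings obtained from a generic function -/

theorem isEpsilonOne_iff {n : ℕ} {X : Set ℕ} :
    IsEpsilonOne n X ↔ HasAnalyticalForm (decide (Odd n)) n X := by
  by_cases h : Odd n <;> simp [IsEpsilonOne, IsPiOne, IsSigmaOne, h]

theorem IsEpsilonOne.numberingJoin {n : ℕ} {ν μ : ℕ → Set ℕ}
    (hν : IsEpsilonOne n (numberingGraph ν)) (hμ : IsEpsilonOne n (numberingGraph μ)) :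
    IsEpsilonOne n (numberingGraph (numberingJoin ν μ)) := by
  rw [isEpsilonOne_iff] at *
  exact hν.numberingJoin hμ

theorem IsEpsilonOne.comp_numbering {n : ℕ} (hn : n ≠ 0) {ν : ℕ → Set ℕ}
    (hν : IsEpsilonOne n (numberingGraph ν)) {h G D p A : ℕ → ℕ} (hG : IsLocallyCheckable G)
    (hD : Computable D) (hp : Computable p) (hh : ∀ k, h k = D (Nat.pair k (G (p k))))
    (hA : Computable A) : IsEpsilonOne n (numberingGraph fun k => ν (A (h k))) := by
  obtain ⟨m, rfl⟩ := Nat.exists_eq_succ_of_ne_zero hn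
  rw [isEpsilonOne_iff] at hν ⊢
  have hl : Computable fun k : ℕ => k.unpair.1 := Computable.fst.comp Computable.unpair
  have hr : Computable fun k : ℕ => k.unpair.2 := Computable.snd.comp Computable.unpair
  have hpair : Computable₂ Nat.pair := Primrec₂.natPair.to_comp
  have := hν.preimage rfl hG
    (D := fun w => Nat.pair (A (D (Nat.pair w.unpair.1.unpair.1 w.unpair.2)))
      w.unpair.1.unpair.2) (p := fun z => p z.unpair.1)
    (hpair.comp (hA.comp (hD.comp (hpair.comp (hl.comp hl) hr))) (hr.comp hl)) (hp.comp hl)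
  convert this using 1
  ext z
  simp [numberingGraph, hh]

theorem numberingJoin_two_mul (ν μ : ℕ → Set ℕ) (k : ℕ) :
    numberingJoin ν μ (2 * k) = ν k := by
  simp [numberingJoin]

theorem numberingJoin_two_mul_add_one (ν μ : ℕ → Set ℕ) (k : ℕ) :
    numberingJoin ν μ (2 * k + 1) = μ k := by
  have h : (2 * k + 1) / 2 = k := by omega
  simp [numberingJoin, h]

theorem range_subset_range_numberingJoin (ν μ : ℕ → Set ℕ) :
    Set.range μ ⊆ Set.range (numberingJoin ν μ) := by
  rintro _ ⟨k, rfl⟩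
  exact ⟨2 * k + 1, numberingJoin_two_mul_add_one ν μ k⟩

theorem range_numberingJoin_subset {ν μ : ℕ → Set ℕ} {S : Set (Set ℕ)} (hν : ∀ k, ν k ∈ S)
    (hμ : ∀ k, μ k ∈ S) : Set.range (numberingJoin ν μ) ⊆ S := by
  rintro _ ⟨k, rfl⟩
  unfold numberingJoin
  split_ifs
  exacts [hν _, hμ _]

/-- The first component of a code of a triple. -/
def tripleFst (a : ℕ) : ℕ := a.unpair.1

/-- The second component of a code of a triple. -/
def tripleSnd (a : ℕ) : ℕ := a.unpair.2.unpair.1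

/-- The number `u` or `v`, depending on the third component of a code of a triple. -/
def tripleSelect (u v a : ℕ) : ℕ := if a.unpair.2.unpair.2 = 0 then u else v

theorem computable_tripleFst : Computable tripleFst := Computable.fst.comp Computable.unpair

theorem computable_tripleSnd : Computable tripleSnd :=
  Computable.fst.comp (Computable.unpair.comp (Computable.snd.comp Computable.unpair))

theorem computable_tripleSelect (u v : ℕ) : Computable (tripleSelect u v) := by
  have : Primrec (tripleSelect u v) := Primrec.ite (Primrec.eq.comp
    (Primrec.snd.comp (Primrec.unpair.comp (Primrec.snd.comp Primrec.unpair)))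
    (Primrec.const 0)) (Primrec.const u) (Primrec.const v)
  exact this.to_comp

/-! ### Reductions defeated by genericity. -/

namespace IsOneGeneric

variable {h : ℕ → ℕ}

theorem surjective (hh : IsOneGeneric h) : Function.Surjective h := by
  intro a
  rcases hh.exists_or_bounded Computable.id Computable.id (Computable.const true) a a with
    ⟨x, -, hx, -⟩ | ⟨l, hl⟩
  · exact ⟨x, hx⟩
  · simpa using hl l

theorem not_reducible_tripleFst (hh : IsOneGeneric h) {ν : ℕ → Set ℕ} {u v : ℕ}
    (huv : ν u ≠ ν v) :
    ¬ NumberingReducible (fun k => ν (tripleSelect u v (h k))) fun k => ν (tripleFst (h k)) := by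
  rintro ⟨f, hf, hfν⟩
  beta_reduce at hfν
  -- This triple at both `x` and `f x` would give ν v on the left and ν u on the right. Otherwise
  -- `f` is bounded by `l` beyond `l`.
  rcases hh.exists_or_bounded Computable.id hf (Computable.const true)
    (Nat.pair u (Nat.pair v 1)) (Nat.pair u (Nat.pair v 1)) with ⟨x, -, h0, h1⟩ | ⟨l, hl⟩
  · have := hfν x
    rw [id] at h0
    rw [h0, h1] at this
    exact huv (by simpa [tripleSelect, tripleFst] using this.symm)
  have hfst : Computable fun k : ℕ => k.unpair.1 := Computable.fst.comp Computable.unpair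
  have hsnd : Computable fun k : ℕ => k.unpair.2 := Computable.snd.comp Computable.unpair
  have hc : Computable fun y : ℕ => decide (f y.unpair.1 = f y.unpair.2) :=
    Primrec.eq.decide.to_comp.comp (hf.comp hfst) (hf.comp hsnd)
  -- Two points with the same image under `f` whose triples select u and v are contradictory. If
  -- genericity yields none, the pigeonhole principle still finds distinct points with equal image
  -- beyond the bound `l'`.
  rcases hh.exists_or_bounded hfst hsnd hc (Nat.pair 0 (Nat.pair 0 0))
    (Nat.pair 0 (Nat.pair 0 1)) with ⟨y, hy, h0, h1⟩ | ⟨l', hl'⟩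
  · have e0 := hfν y.unpair.1
    have e1 := hfν y.unpair.2
    rw [← of_decide_eq_true hy, ← e0, h0, h1] at e1
    exact huv (by simpa [tripleSelect] using e1.symm)
  · have hmaps : ∀ i ∈ Finset.range (l + 1), f (l + l' + i) ∈ Finset.range l := by
      intro i _
      rcases hl (l + l' + i) rfl with h | h | h
      · simp only [id] at h; omega
      · exact Finset.mem_range.2 h
      · exact absurd rfl h.1
    obtain ⟨i, -, j, -, hij, hfij⟩ :=
      Finset.exists_ne_map_eq_of_card_lt_of_maps_to (by simp) hmaps
    have := hl' (Nat.pair (l + l' + i) (l + l' + j)) (by simpa using hfij)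
    simp only [Nat.unpair_pair] at this
    omega

theorem finite_range_of_reducible (hh : IsOneGeneric h) {ν γ : ℕ → Set ℕ} {u v : ℕ}
    (huv : ν u ≠ ν v)
    (h₀ : NumberingReducible γ (numberingJoin (fun k => ν (tripleSelect u v (h k)))
      fun k => ν (tripleFst (h k))))
    (h₁ : NumberingReducible γ (numberingJoin (fun k => ν (tripleSelect u v (h k)))
      fun k => ν (tripleSnd (h k)))) : (Set.range γ).Finite := by
  obtain ⟨p, hp, hpγ⟩ := h₀
  obtain ⟨q, hq, hqγ⟩ := h₁
  have hdiv : Computable fun k : ℕ => k / 2 :=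
    (Primrec.nat_div.comp Primrec.id (Primrec.const 2)).to_comp
  have hmod : Computable fun k : ℕ => decide (k % 2 = 1) :=
    (Primrec.eq.comp (Primrec.nat_mod.comp Primrec.id (Primrec.const 2))
      (Primrec.const 1)).decide.to_comp
  have hodd : ∀ {μ μ' : ℕ → Set ℕ} {k : ℕ}, k % 2 = 1 → numberingJoin μ μ' k = μ' (k / 2) :=
    fun hk => by simp [numberingJoin, hk]
  have heven : ∀ {μ : ℕ → Set ℕ} {k : ℕ}, k % 2 ≠ 1 →
      numberingJoin (fun k => ν (tripleSelect u v (h k))) μ k ∈ ({ν u, ν v} : Set (Set ℕ)) := by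
    intro μ k hk
    have : k % 2 = 0 := by omega
    simp only [numberingJoin, this, if_true, tripleSelect]
    split_ifs <;> simp
  -- When both reductions land in the right summands, the same triple at both points equates ν u
  -- with ν v; using one triple does no harm if the points coincide. So one of the two points is
  -- always below `l`.
  rcases hh.exists_or_bounded (hdiv.comp hp) (hdiv.comp hq)
    (Primrec.and.to_comp.comp (hmod.comp hp) (hmod.comp hq))
    (Nat.pair u (Nat.pair v 0)) (Nat.pair u (Nat.pair v 0)) with ⟨x, hx, h0, h1⟩ | ⟨l, hl⟩
  · simp only [Bool.and_eq_true, decide_eq_true_eq] at hx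
    have e := (hpγ x).symm.trans (hqγ x)
    rw [hodd hx.1, hodd hx.2, h0, h1] at e
    exact absurd (by simpa [tripleFst, tripleSnd] using e) huv
  · refine ((Set.toFinite ({ν u, ν v} : Set (Set ℕ))).union
      (((Set.finite_Iio l).image fun k => ν (tripleFst (h k))).union
        ((Set.finite_Iio l).image fun k => ν (tripleSnd (h k))))).subset ?_
    rintro _ ⟨x, rfl⟩
    by_cases hpx : p x % 2 = 1
    · by_cases hqx : q x % 2 = 1
      · right
        rcases hl x (by simp [hpx, hqx]) with h | h | h
        · left
          exact ⟨p x / 2, h, by rw [hpγ, hodd hpx]⟩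
        · right
          exact ⟨q x / 2, h, by rw [hqγ, hodd hqx]⟩
        · exact absurd rfl h.1
      · left; rw [hqγ]; exact heven hqx
    · left; rw [hpγ]; exact heven hpx

end IsOneGeneric

theorem exists_epsilonNumbering_not_split {n : ℕ} (hn : n ≠ 0) {S : Set (Set ℕ)}
    (hS : S.Infinite) (hcomp : IsEpsilonComputableFamily n S) :
    ∃ β α₀ α₁ : EpsilonNumbering n S, β ≤ α₀.join α₁ ∧ ¬ β ≤ α₁ ∧
      ∀ γ : EpsilonNumbering n S, γ ≤ β → ¬ γ ≤ α₀ := by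
  obtain ⟨ν, hνS, hν⟩ := hcomp
  obtain ⟨u, v, huv⟩ : ∃ u v, ν u ≠ ν v := by
    by_contra! hcon
    refine hS (hνS ▸ (Set.finite_singleton (ν 0)).subset ?_)
    rintro _ ⟨k, rfl⟩
    exact hcon k 0
  have hνmem : ∀ k, ν k ∈ S := fun k => hνS ▸ ⟨k, rfl⟩
  obtain ⟨h, G, D, p, hh, hG, hD, hp, hrep⟩ := exists_isOneGeneric
  have hE : ∀ {A : ℕ → ℕ}, Computable A →
      IsEpsilonOne n (numberingGraph fun k => ν (A (h k))) :=
    fun hA => hν.comp_numbering hn hG hD hp hrep hA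
  let σ : ℕ → Set ℕ := fun k => ν (tripleSelect u v (h k))
  let ε : ℕ → Set ℕ := fun k => ν (tripleFst (h k))
  let δ : ℕ → Set ℕ := fun k => ν (tripleSnd (h k))
  have hσE : IsEpsilonOne n (numberingGraph σ) := hE (computable_tripleSelect u v)
  have hεE : IsEpsilonOne n (numberingGraph ε) := hE computable_tripleFst
  have hδE : IsEpsilonOne n (numberingGraph δ) := hE computable_tripleSnd
  have hεS : S ⊆ Set.range ε := by
    rw [← hνS]
    rintro _ ⟨k, rfl⟩
    obtain ⟨x, hx⟩ := hh.surjective (Nat.pair k 0)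
    exact ⟨x, by simp [ε, hx, tripleFst]⟩
  have hδS : S ⊆ Set.range δ := by
    rw [← hνS]
    rintro _ ⟨k, rfl⟩
    obtain ⟨x, hx⟩ := hh.surjective (Nat.pair 0 (Nat.pair k 0))
    exact ⟨x, by simp [δ, hx, tripleSnd]⟩
  have hjoin : ∀ {μ : ℕ → Set ℕ}, IsEpsilonOne n (numberingGraph μ) → S ⊆ Set.range μ →
      (∀ k, μ k ∈ S) → IsEpsilonNumbering n S (numberingJoin σ μ) := fun hμ hμS hμS' =>
    ⟨(range_numberingJoin_subset (fun _ => hνmem _) hμS').antisymm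
      (hμS.trans (range_subset_range_numberingJoin _ _)), hσE.numberingJoin hμ⟩
  have hεrange : Set.range ε = S := by
    refine Set.Subset.antisymm ?_ hεS
    rintro _ ⟨k, rfl⟩
    exact hνmem _
  have hdouble : Computable fun k : ℕ => 2 * k :=
    (Primrec.nat_mul.comp (Primrec.const 2) Primrec.id).to_comp
  let β : EpsilonNumbering n S := ⟨numberingJoin σ ε, hjoin hεE hεS fun _ => hνmem _⟩
  let α₀ : EpsilonNumbering n S := ⟨numberingJoin σ δ, hjoin hδE hδS fun _ => hνmem _⟩
  let α₁ : EpsilonNumbering n S := ⟨ε, hεrange, hεE⟩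
  refine ⟨β, α₀, α₁, ?_, ?_, ?_⟩
  · have hdiv : Computable fun k : ℕ => k / 2 :=
      (Primrec.nat_div.comp Primrec.id (Primrec.const 2)).to_comp
    have hmod : Computable fun k : ℕ => decide (k % 2 = 0) :=
      (Primrec.eq.comp (Primrec.nat_mod.comp Primrec.id (Primrec.const 2))
        (Primrec.const 0)).decide.to_comp
    refine ⟨fun k => bif decide (k % 2 = 0) then 2 * (2 * (k / 2)) else 2 * (k / 2) + 1,
      Computable.cond hmod (hdouble.comp (hdouble.comp hdiv))
        (Computable.succ.comp (hdouble.comp hdiv)), fun k => ?_⟩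
    change numberingJoin σ ε k = numberingJoin (numberingJoin σ δ) ε _
    by_cases hk : k % 2 = 0
    · simp only [hk, decide_true, cond_true, numberingJoin_two_mul]
      simp [numberingJoin, hk]
    · simp only [hk, decide_false, cond_false, numberingJoin_two_mul_add_one]
      simp [numberingJoin, hk]
  · rintro ⟨f, hf, hfβ⟩
    refine hh.not_reducible_tripleFst huv ⟨fun k => f (2 * k), hf.comp hdouble, fun k => ?_⟩
    exact (numberingJoin_two_mul σ ε k).symm.trans (hfβ (2 * k))
  · intro γ h₀ h₁
    refine hS ?_
    rw [← γ.2.1]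
    exact hh.finite_range_of_reducible huv h₀ h₁

/-! ### Distributivity -/

theorem IsDistributiveSup.withBot {A : Type*} [SemilatticeSup A] (hA : IsDistributiveSup A) :
    IsWeaklyDistributiveSup A := by
  intro b a₀ a₁ h
  induction b with
  | bot => exact ⟨⊥, ⊥, by simp, bot_le, bot_le⟩
  | coe b =>
    induction a₀ with
    | bot => exact ⟨⊥, b, by simp, bot_le, by simpa using h⟩
    | coe a₀ =>
      induction a₁ with
      | bot => exact ⟨b, ⊥, by simp, by simpa using h, bot_le⟩
      | coe a₁ =>
        obtain ⟨b₀, b₁, rfl, h₀, h₁⟩ := hA b a₀ a₁ (by exact_mod_cast h)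
        exact ⟨b₀, b₁, WithBot.coe_sup _ _, WithBot.coe_le_coe.2 h₀, WithBot.coe_le_coe.2 h₁⟩

theorem mainTheorem3 (n : ℕ) (hn : n ≠ 0) (S : Set (Set ℕ)) (hS : S.Infinite)
    (hcomp : IsEpsilonComputableFamily n S) :
    ¬ IsWeaklyDistributiveSup (RogersSemilattice n S) ∧
      ¬ IsDistributiveSup (RogersSemilattice n S) := by
  suffices h : ¬ IsWeaklyDistributiveSup (RogersSemilattice n S) from
    ⟨h, fun hA => h hA.withBot⟩
  intro hdist
  obtain ⟨β, α₀, α₁, hle, hβ, hγ⟩ := exists_epsilonNumbering_not_split hn hS hcomp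
  let deg : EpsilonNumbering n S → RogersSemilattice n S := toAntisymmetrization (· ≤ ·)
  have hsup : deg β ≤ deg α₀ ⊔ deg α₁ := hle
  obtain ⟨b₀, b₁, hb, h₀, h₁⟩ := hdist (deg β) (deg α₀) (deg α₁) (by
    rw [← WithBot.coe_sup]
    exact WithBot.coe_le_coe.2 hsup)
  -- If b₀ is the external ⊥, then b₁ is all of β. Otherwise b₀ is the degree of a numbering of S
  -- below both β and α₀.
  induction b₀ with
  | bot =>
    rw [bot_sup_eq] at hb
    rw [← hb] at h₁
    have h₁ : deg β ≤ deg α₁ := WithBot.coe_le_coe.1 h₁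
    exact hβ h₁
  | coe b₀ =>
    have hb₀ : b₀ ≤ deg β := WithBot.coe_le_coe.1 (hb ▸ le_sup_left)
    have h₀ : b₀ ≤ deg α₀ := WithBot.coe_le_coe.1 h₀
    induction b₀ using Quotient.inductionOn with
    | h γ => exact hγ γ hb₀ h₀
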